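/- For integers $k>0$ and $q$, let $J(k,2q)$ be the 2-bridge knot whose group has the presentation $\langle a,b\mid w^{q}a=bw^{q}\rangle$, where $w=(ba^{-1})^m(b^{-1}a)^m$ if $k=2m$ and $w=(ba^{-1})^m\,ba\,(b^{-1}a)^m$ if $k=2m+1$. Let $\rho$ be the homomorphism from the free group on $a,b$ to $SL(2,\mathbb{Z}[s^{\pm1},y])$ with $$\rho(a)=\begin{pmatrix} s&1\\0&s^{-1}\end{pmatrix},\qquad \rho(b)=\begin{pmatrix} s&0\\-y&s^{-1}\end{pmatrix}.$$ The Riley polynomial of $J(k,2q)$ is $\phi_{k,q}(s,y)=u^{11}+(s^{-1}-s)\,u^{12}\in\mathbb{Z}[s^{\pm1},y]$, where $(u^{ij})=\rho(w^{q})$. The degree of a nonzero element of $\mathbb{Z}[s^{\pm1},y]$ is the maximum of $i+j$ over all monomials $s^iy^j$ ($i\in\mathbb{Z}$, $j\ge 0$) that occur in it with nonzero coefficient. **Proposition 5.2.** For all integers $k>0$ and $q$, the polynomial $\phi_{k,q}(s,y)$ is nonzero whenever $q\neq 0$, and $$\deg\phi_{k,q}(s,y)=\begin{cases}(k+1)q-1,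 & q>0,\ k\neq 1;\\ (k+1)|q|, & q<0;\\ 2q-2, & q>0,\ k=1.\end{cases}$$ -/

import Mathlib

noncomputable section

namespace Riley

/-- The ring `ℤ[s^{±1}, y]`: polynomials in `y` over the integer Laurent polynomials in `s`. -/
abbrev LaurentRing : Type := Polynomial (LaurentPolynomial ℤ)

/-- The element `s ^ n` of `ℤ[s^{±1}, y]`, for an integer `n`. -/
def s (n : ℤ) : LaurentRing := Polynomial.C (LaurentPolynomial.T n)

/-- The variable `y` of `ℤ[s^{±1}, y]`. -/
def y : LaurentRing := Polynomial.X

/-- The degree of an element of `ℤ[s^{±1}, y]`: the largest value of `i + j` over all the monomials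
`s ^ i * y ^ j` (`i` an integer, `j` a natural number) which occur in it with a nonzero coefficient,
and `⊥` for the zero element. -/
def deg (p : LaurentRing) : WithBot ℤ :=
  p.support.sup fun j => (p.coeff j).coeff.support.sup fun i => ((i + (j : ℤ) : ℤ) : WithBot ℤ)

theorem s_mul_s_neg (n : ℤ) : s n * s (-n) = 1 := by
  rw [s, s, ← Polynomial.C_mul, ← LaurentPolynomial.T_add, add_neg_cancel,
    LaurentPolynomial.T_zero, Polynomial.C_1]

/-- The image `A = (s, 1; 0, s⁻¹)` of the generator `a`. -/
def matA : Matrix.SpecialLinearGroup (Fin 2) LaurentRing :=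
  ⟨!![s 1, 1; 0, s (-1)], by simp [Matrix.det_fin_two_of, s_mul_s_neg]⟩

/-- The image `B = (s, 0; -y, s⁻¹)` of the generator `b`. -/
def matB : Matrix.SpecialLinearGroup (Fin 2) LaurentRing :=
  ⟨!![s 1, 0; -y, s (-1)], by simp [Matrix.det_fin_two_of, s_mul_s_neg]⟩

/-- The generator `a` of the free group on two generators. -/
def a : FreeGroup (Fin 2) := FreeGroup.of 0

/-- The generator `b` of the free group on two generators. -/
def b : FreeGroup (Fin 2) := FreeGroup.of 1

/-- The homomorphism from the free group on `a, b` with `a ↦ A` and `b ↦ B`. -/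
def rho : FreeGroup (Fin 2) →* Matrix.SpecialLinearGroup (Fin 2) LaurentRing :=
  FreeGroup.lift ![matA, matB]

/-- The Riley polynomial `w¹¹ + (s⁻¹ - s) w¹²` of a presentation `⟨a, b | w a = b w⟩`, where
`(wⁱʲ)` is the matrix `ρ(w)`. -/
def rileyOfWord (w : FreeGroup (Fin 2)) : LaurentRing :=
  (rho w).1 0 0 + (s (-1) - s 1) * (rho w).1 0 1

/-- The word `(b a⁻¹)^m (b⁻¹ a)^m` if `k = 2 m`, and `(b a⁻¹)^m b a (b⁻¹ a)^m` if `k = 2 m + 1`.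
The knot group of `J(k, 2q)` is `⟨a, b | (jWord k)^q a = b (jWord k)^q⟩`. -/
def jWord (k : ℕ) : FreeGroup (Fin 2) :=
  if Even k then (b * a⁻¹) ^ (k / 2) * (b⁻¹ * a) ^ (k / 2)
  else (b * a⁻¹) ^ (k / 2) * (b * a) * (b⁻¹ * a) ^ (k / 2)

/-- The Riley polynomial `φ_{k,q}(s, y)` of the knot `J(k, 2q)`. -/
def rileyJ (k : ℕ) (q : ℤ) : LaurentRing := rileyOfWord (jWord k ^ q)

end Riley

end

noncomputable section

namespace Riley

open Polynomial

/-! By Cayley–Hamilton, a matrix `M` of determinant one and trace `t` satisfies `M ^ q = S_{q-1}(t)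
M - S_{q-2}(t)`, so `φ_q = S_{q-1}(t) φ_1 - S_{q-2}(t)`, where `t` is the trace of `ρ(w)`. It
remains to find the top-degree terms of `t` and `φ_1`.

Both `b a⁻¹` and `b⁻¹ a` have trace `y + 2`, so the same formula makes `t` and `φ_1` explicit in
`S_{m-1}(y + 2)` and its neighbours. In each, one term carrying `s²` dominates: `t` has degree `k +
1` and `φ_1` degree `k`, except that `φ_1 = 1` for `k = 1`. For `q > 0` the first summand of `φ_q`
wins; for `q < 0` the second does, as `deg φ_1 < deg t`.

Tracking a single leading monomial (`HasLead`) rather than a degree bound rules out cancellation. An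
integer value of `deg` also gives nonvanishing, as `deg 0 = ⊥`. -/

/-- The additive subgroup of the elements of `ℤ[s^{±1}, y]` of degree at most `n`. -/
def degLE (n : ℤ) : AddSubgroup LaurentRing where
  carrier := {p | ∀ (j : ℕ) (i : ℤ), n < i + j → (p.coeff j).coeff i = 0}
  zero_mem' := by intro j i _; simp
  add_mem' := by
    intro p q hp hq j i h
    simp [hp j i h, hq j i h]
  neg_mem' := by
    intro p hp j i h
    simp [hp j i h]

theorem mem_degLE {n : ℤ} {p : LaurentRing} :
    p ∈ degLE n ↔ ∀ (j : ℕ) (i : ℤ), n < i + j → (p.coeff j).coeff i = 0 := Iff.rfl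

theorem degLE_mono {m n : ℤ} (h : m ≤ n) : degLE m ≤ degLE n :=
  fun _ hp j i hji => hp j i (h.trans_lt hji)

theorem mul_mem_degLE {m n k : ℤ} {p q : LaurentRing} (hp : p ∈ degLE m) (hq : q ∈ degLE n)
    (h : m + n ≤ k) : p * q ∈ degLE k := by
  intro j i hji
  rw [Polynomial.coeff_mul, AddMonoidAlgebra.coeff_sum, Finsupp.finsetSum_apply]
  refine Finset.sum_eq_zero fun x hx => ?_
  rw [AddMonoidAlgebra.coeff_mul]
  refine Finset.sum_eq_zero fun i₁ _ => Finset.sum_eq_zero fun i₂ _ => ?_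
  have hx' : (x.1 : ℤ) + x.2 = j := by exact_mod_cast Finset.HasAntidiagonal.mem_antidiagonal.mp hx
  dsimp only
  split_ifs with hi
  · by_cases h₁ : m < i₁ + x.1
    · rw [mem_degLE.mp hp _ _ h₁, zero_mul]
    · rw [mem_degLE.mp hq x.2 i₂ (by omega), mul_zero]
  · rfl

/-- The monomial `c s ^ i y ^ j`. -/
def mono (c i : ℤ) (j : ℕ) : LaurentRing := monomial j (AddMonoidAlgebra.single i c)

theorem mono_mul_mono (c₁ c₂ i₁ i₂ : ℤ) (j₁ j₂ : ℕ) :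
    mono c₁ i₁ j₁ * mono c₂ i₂ j₂ = mono (c₁ * c₂) (i₁ + i₂) (j₁ + j₂) := by
  rw [mono, mono, mono, monomial_mul_monomial, AddMonoidAlgebra.single_mul_single]

theorem mono_mem_degLE {c i n : ℤ} {j : ℕ} (h : i + j ≤ n) : mono c i j ∈ degLE n := by
  intro j' i' h'
  rw [mono, coeff_monomial]
  split_ifs with hj
  · subst hj
    rw [AddMonoidAlgebra.coeff_single, Finsupp.single_eq_of_ne (by omega)]
  · simp

theorem s_eq_mono (n : ℤ) : s n = mono 1 n 0 := rfl

theorem y_eq_mono : y = mono 1 0 1 := rfl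

theorem one_eq_mono : (1 : LaurentRing) = mono 1 0 0 := rfl

theorem s_mem_degLE (n : ℤ) : s n ∈ degLE n := by
  rw [s_eq_mono]; exact mono_mem_degLE (by simp)

theorem y_mem_degLE : y ∈ degLE 1 := by
  rw [y_eq_mono]; exact mono_mem_degLE (by simp)

theorem one_mem_degLE : (1 : LaurentRing) ∈ degLE 0 := by
  rw [one_eq_mono]; exact mono_mem_degLE (by simp)

/-- `p` is the sum of a nonzero monomial of degree `d` and of terms of degree less than `d`. -/
def HasLead (p : LaurentRing) (d : ℤ) : Prop :=
  ∃ (c i : ℤ) (j : ℕ), c ≠ 0 ∧ i + j = d ∧ p - mono c i j ∈ degLE (d - 1)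

theorem hasLead_mono {c i d : ℤ} {j : ℕ} (hc : c ≠ 0) (h : i + j = d) :
    HasLead (mono c i j) d :=
  ⟨c, i, j, hc, h, by rw [sub_self]; exact zero_mem _⟩

theorem hasLead_s (n : ℤ) : HasLead (s n) n := by
  rw [s_eq_mono]; exact hasLead_mono one_ne_zero (by simp)

theorem hasLead_y : HasLead y 1 := by
  rw [y_eq_mono]; exact hasLead_mono one_ne_zero (by simp)

theorem hasLead_one : HasLead 1 0 := by
  rw [one_eq_mono]; exact hasLead_mono one_ne_zero (by simp)

namespace HasLead

variable {p q : LaurentRing} {d e : ℤ}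

theorem mem_degLE (h : HasLead p d) : p ∈ degLE d := by
  obtain ⟨c, i, j, _, hd, h⟩ := h
  rw [← sub_add_cancel p (mono c i j)]
  exact add_mem (degLE_mono (by omega) h) (mono_mem_degLE hd.le)

theorem add (h : HasLead p d) (hq : q ∈ degLE (d - 1)) : HasLead (p + q) d := by
  obtain ⟨c, i, j, hc, hd, h⟩ := h
  refine ⟨c, i, j, hc, hd, ?_⟩
  rw [add_sub_right_comm]
  exact add_mem h hq

theorem neg (h : HasLead p d) : HasLead (-p) d := by
  obtain ⟨c, i, j, hc, hd, h⟩ := h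
  refine ⟨-c, i, j, neg_ne_zero.mpr hc, hd, ?_⟩
  have : -p - mono (-c) i j = -(p - mono c i j) := by simp [mono]; ring
  rw [this]
  exact neg_mem h

theorem mul (hp : HasLead p d) (hq : HasLead q e) : HasLead (p * q) (d + e) := by
  have hq' := hq.mem_degLE
  obtain ⟨c₁, i₁, j₁, hc₁, hd₁, h₁⟩ := hp
  obtain ⟨c₂, i₂, j₂, hc₂, hd₂, h₂⟩ := hq
  refine ⟨c₁ * c₂, i₁ + i₂, j₁ + j₂, mul_ne_zero hc₁ hc₂, by push_cast; omega, ?_⟩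
  rw [← mono_mul_mono]
  have : p * q - mono c₁ i₁ j₁ * mono c₂ i₂ j₂
      = (p - mono c₁ i₁ j₁) * q + mono c₁ i₁ j₁ * (q - mono c₂ i₂ j₂) := by ring
  rw [this]
  exact add_mem (mul_mem_degLE h₁ hq' (by omega))
    (mul_mem_degLE (mono_mem_degLE hd₁.le) h₂ (by omega))

theorem deg_eq (h : HasLead p d) : deg p = (d : WithBot ℤ) := by
  have hle := h.mem_degLE
  obtain ⟨c, i, j, hc, hd, h⟩ := h
  have hcoeff : (p.coeff j).coeff i = c := by
    have := h j i (by omega)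
    rw [coeff_sub, AddMonoidAlgebra.coeff_sub, Finsupp.sub_apply, mono, coeff_monomial_same,
      AddMonoidAlgebra.coeff_single, Finsupp.single_eq_same] at this
    omega
  apply le_antisymm
  · refine Finset.sup_le fun j' _ => Finset.sup_le fun i' hi' => ?_
    rw [WithBot.coe_le_coe]
    by_contra hlt
    exact Finsupp.mem_support_iff.mp hi' (hle j' i' (not_le.mp hlt))
  · have hi : i ∈ (p.coeff j).coeff.support := by
      rw [Finsupp.mem_support_iff, hcoeff]; exact hc
    have hj : j ∈ p.support := by
      rw [mem_support_iff]
      rintro h0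
      rw [h0] at hcoeff
      exact hc hcoeff.symm
    rw [← hd]
    exact (Finset.le_sup (f := fun i : ℤ => ((i + (j : ℤ) : ℤ) : WithBot ℤ)) hi).trans
      (Finset.le_sup (f := fun j : ℕ => (p.coeff j).coeff.support.sup
        fun i => ((i + (j : ℤ) : ℤ) : WithBot ℤ)) hj)

end HasLead

/-! ### Chebyshev polynomials and powers of 2 × 2 matrices. -/

section Chebyshev

variable {R : Type*} [CommRing R]

/-- The value at `t` of the rescaled Chebyshev polynomial `S n`. -/
def chebS (t : R) (n : ℤ) : R := (Chebyshev.S R n).eval t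

theorem chebS_add_one (t : R) (n : ℤ) : chebS t (n + 1) = t * chebS t n - chebS t (n - 1) := by
  simp [chebS, Chebyshev.S_add_one]

theorem chebS_zero (t : R) : chebS t 0 = 1 := by simp [chebS]

theorem chebS_neg_one (t : R) : chebS t (-1) = 0 := by simp [chebS]

theorem chebS_neg_two (t : R) : chebS t (-2) = -1 := by simp [chebS]

theorem chebS_neg (t : R) (n : ℤ) : chebS t (-n) = -chebS t (n - 2) := by
  simp [chebS, Chebyshev.S_neg]

/-- The powers of a `2 × 2` matrix of determinant one in terms of Chebyshev polynomials. -/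
theorem coe_zpow_eq (M : Matrix.SpecialLinearGroup (Fin 2) R) (n : ℤ) :
    ((M ^ n : Matrix.SpecialLinearGroup (Fin 2) R) : Matrix (Fin 2) (Fin 2) R) =
      chebS (M.1 0 0 + M.1 1 1) (n - 1) • M.1
        - chebS (M.1 0 0 + M.1 1 1) (n - 2) • (1 : Matrix (Fin 2) (Fin 2) R) := by
  set t := M.1 0 0 + M.1 1 1 with ht
  have hdet : M.1 0 0 * M.1 1 1 - M.1 0 1 * M.1 1 0 = 1 := by
    rw [← Matrix.det_fin_two]; exact M.2
  have hmul : M.1 * M.1 = t • M.1 - 1 := by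
    ext i j
    fin_cases i <;> fin_cases j <;> simp [Matrix.mul_apply, Fin.sum_univ_two, ht] <;>
      first | ring1 | linear_combination -hdet
  have hinv : ((M⁻¹ : Matrix.SpecialLinearGroup (Fin 2) R) : Matrix (Fin 2) (Fin 2) R)
      = t • 1 - M.1 := by
    ext i j
    fin_cases i <;> fin_cases j <;> simp [Matrix.SpecialLinearGroup.coe_inv, Matrix.adjugate_fin_two, ht]
  have hmulinv : M.1 * (t • 1 - M.1) = 1 := by
    rw [mul_sub, hmul, mul_smul_comm, mul_one, sub_sub_cancel]
  induction n with
  | zero => simp [chebS_neg_one, chebS_neg_two]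
  | succ n ih =>
    have h := chebS_add_one t ((n : ℤ) - 1)
    rw [sub_add_cancel, sub_sub, one_add_one_eq_two] at h
    rw [zpow_add_one, Matrix.SpecialLinearGroup.coe_mul, ih, add_sub_cancel_right, h,
      show (n : ℤ) + 1 - 2 = n - 1 by ring, sub_mul, smul_mul_assoc, hmul, smul_mul_assoc, one_mul,
      smul_sub, sub_smul, smul_smul, mul_comm t]
    abel
  | pred n ih =>
    have h := chebS_add_one t (-(n : ℤ) - 2)
    rw [show -(n : ℤ) - 2 + 1 = -n - 1 by ring, show -(n : ℤ) - 2 - 1 = -n - 1 - 2 by ring] at h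
    rw [zpow_sub_one, Matrix.SpecialLinearGroup.coe_mul, ih, hinv, sub_mul, smul_mul_assoc, hmulinv,
      smul_mul_assoc, one_mul, show -(n : ℤ) - 1 - 1 = -n - 2 by ring, h, smul_sub, smul_smul]
    module

end Chebyshev

/-- In `S_{n+1} = t S_n - S_{n-1}` the first term dominates because `t` has positive degree. -/
theorem HasLead.chebS {t : LaurentRing} {d : ℤ} (ht : HasLead t d) (hd : 1 ≤ d) (n : ℕ) :
    HasLead (chebS t n) (n * d) := by
  induction n using Nat.strong_induction_on with
  | _ n ih =>
    match n with
    | 0 => simpa [chebS_zero] using hasLead_one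
    | 1 =>
      have := chebS_add_one t 0
      rw [chebS_zero, zero_sub, chebS_neg_one] at this
      rw [zero_add, mul_one, sub_zero] at this
      simpa [this] using ht
    | n + 2 =>
      have h := chebS_add_one t ((n : ℤ) + 1)
      have h₁ := ht.mul (ih (n + 1) (by omega))
      have h₀ := (ih n (by omega)).neg.mem_degLE
      push_cast at h₁ h₀ ⊢
      rw [show (n : ℤ) + 2 = n + 1 + 1 by ring, h, add_sub_cancel_right, sub_eq_add_neg,
        show ((n : ℤ) + 1 + 1) * d = d + (n + 1) * d by ring]
      exact h₁.add (degLE_mono (by linarith) h₀)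

/-- The Riley polynomial of `w ^ q` in terms of the trace of `w` and the Riley polynomial of `w`. -/
theorem rileyOfWord_zpow (w : FreeGroup (Fin 2)) (q : ℤ) :
    rileyOfWord (w ^ q) = chebS ((rho w).1 0 0 + (rho w).1 1 1) (q - 1) * rileyOfWord w
      - chebS ((rho w).1 0 0 + (rho w).1 1 1) (q - 2) := by
  rw [rileyOfWord, map_zpow, coe_zpow_eq, rileyOfWord]
  simp
  ring

theorem hasLead_rileyOfWord_zpow_of_pos {w : FreeGroup (Fin 2)} {d e : ℤ}
    (ht : HasLead ((rho w).1 0 0 + (rho w).1 1 1) d) (hw : HasLead (rileyOfWord w) e)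
    (hd : 1 ≤ d) (he : 0 ≤ e) {q : ℤ} (hq : 0 < q) :
    HasLead (rileyOfWord (w ^ q)) ((q - 1) * d + e) := by
  obtain ⟨n, rfl⟩ : ∃ n : ℕ, q = n + 1 := ⟨(q - 1).toNat, by omega⟩
  rw [rileyOfWord_zpow]
  generalize (rho w).1 0 0 + (rho w).1 1 1 = t at *
  rw [sub_eq_add_neg, add_sub_cancel_right]
  refine ((ht.chebS hd n).mul hw).add (neg_mem ?_)
  -- For `q = 1` the second summand is `S_{-1} = 0`, whose index is not a natural number.
  rcases n with _ | n
  · norm_num [chebS_neg_one]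
  · have := (ht.chebS hd n).mem_degLE
    push_cast
    rw [show (n : ℤ) + 1 + 1 - 2 = n by ring]
    exact degLE_mono (by linarith) this

theorem hasLead_rileyOfWord_zpow_of_neg {w : FreeGroup (Fin 2)} {d e : ℤ}
    (ht : HasLead ((rho w).1 0 0 + (rho w).1 1 1) d) (hw : HasLead (rileyOfWord w) e)
    (hd : 1 ≤ d) (he : e < d) {q : ℤ} (hq : q < 0) :
    HasLead (rileyOfWord (w ^ q)) (d * |q|) := by
  obtain ⟨n, rfl⟩ : ∃ n : ℕ, q = -(n + 1) := ⟨(-q - 1).toNat, by omega⟩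
  rw [rileyOfWord_zpow]
  generalize (rho w).1 0 0 + (rho w).1 1 1 = t at *
  -- The reflection `S_{-n} = -S_{n-2}` turns the formula into `S_{|q|}(t) - S_{|q|-1}(t) φ_1`.
  rw [show -((n : ℤ) + 1) - 1 = -(n + 2) by ring,
    show -((n : ℤ) + 1) - 2 = -(n + 3) by ring, chebS_neg, chebS_neg, abs_neg,
    show (n : ℤ) + 3 - 2 = (n + 1 : ℕ) by push_cast; ring, add_sub_cancel_right, sub_neg_eq_add,
    add_comm (-_ * _), abs_of_pos (by positivity), mul_comm d]
  have h₁ := ht.chebS hd (n + 1)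
  rw [Nat.cast_succ] at h₁ ⊢
  convert h₁.add (neg_mem (degLE_mono (by linarith) ((ht.chebS hd n).mul hw).mem_degLE)) using 1
  ring

/-! ### The matrix of `jWord k`: its trace and Riley polynomial. -/

theorem rho_a : rho a = matA := by simp [rho, a]

theorem rho_b : rho b = matB := by simp [rho, b]

theorem s_neg_mul_s : s (-1) * s 1 = 1 := by rw [mul_comm, s_mul_s_neg]

theorem coe_inv_matA : (matA⁻¹).1 = !![s (-1), -1; 0, s 1] := by
  rw [Matrix.SpecialLinearGroup.coe_inv, matA, Matrix.adjugate_fin_two]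
  simp

theorem coe_inv_matB : (matB⁻¹).1 = !![s (-1), 0; y, s 1] := by
  rw [Matrix.SpecialLinearGroup.coe_inv, matB, Matrix.adjugate_fin_two]
  simp

theorem coe_rho_b_mul_inv_a :
    (rho (b * a⁻¹)).1 = !![1, -s 1; -(y * s (-1)), y + 1] := by
  rw [map_mul, map_inv, rho_a, rho_b, Matrix.SpecialLinearGroup.coe_mul, coe_inv_matA]
  simp [matB, s_mul_s_neg, s_neg_mul_s]
  refine ⟨?_, ?_, ?_⟩ <;> ring

theorem coe_rho_inv_b_mul_a :
    (rho (b⁻¹ * a)).1 = !![1, s (-1); y * s 1, y + 1] := by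
  rw [map_mul, map_inv, rho_a, rho_b, Matrix.SpecialLinearGroup.coe_mul, coe_inv_matB]
  simp [matA, s_mul_s_neg, s_neg_mul_s]

theorem coe_rho_b_mul_a :
    (rho (b * a)).1 = !![s 1 * s 1, s 1; -(y * s 1), -y + s (-1) * s (-1)] := by
  rw [map_mul, rho_a, rho_b, Matrix.SpecialLinearGroup.coe_mul]
  simp [matA, matB]
  ring

theorem coe_rho_b_mul_inv_a_pow (m : ℕ) :
    (rho ((b * a⁻¹) ^ m)).1 =
      !![chebS (y + 2) (m - 1) - chebS (y + 2) (m - 2), -(s 1 * chebS (y + 2) (m - 1));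
        -(y * s (-1) * chebS (y + 2) (m - 1)),
        (y + 1) * chebS (y + 2) (m - 1) - chebS (y + 2) (m - 2)] := by
  rw [map_pow, ← zpow_natCast, coe_zpow_eq, coe_rho_b_mul_inv_a]
  have : (1 : LaurentRing) + (y + 1) = y + 2 := by ring
  apply Matrix.ext
  intro i j
  fin_cases i <;> fin_cases j <;> simp [this] <;> ring

theorem coe_rho_inv_b_mul_a_pow (m : ℕ) :
    (rho ((b⁻¹ * a) ^ m)).1 =
      !![chebS (y + 2) (m - 1) - chebS (y + 2) (m - 2), s (-1) * chebS (y + 2) (m - 1);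
        y * s 1 * chebS (y + 2) (m - 1),
        (y + 1) * chebS (y + 2) (m - 1) - chebS (y + 2) (m - 2)] := by
  rw [map_pow, ← zpow_natCast, coe_zpow_eq, coe_rho_inv_b_mul_a]
  have : (1 : LaurentRing) + (y + 1) = y + 2 := by ring
  apply Matrix.ext
  intro i j
  fin_cases i <;> fin_cases j <;> simp [this] <;> ring

theorem hasLead_y_add_two : HasLead (y + 2) 1 := by
  refine hasLead_y.add ?_
  rw [← one_add_one_eq_two]
  exact add_mem one_mem_degLE one_mem_degLE

theorem chebS_y_add_two_mem_degLE (m : ℕ) : chebS (y + 2) ((m : ℤ) - 1) ∈ degLE (m - 1) := by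
  rcases m with _ | m
  · simp [chebS_neg_one]
  · simpa using (hasLead_y_add_two.chebS le_rfl m).mem_degLE

theorem hasLead_chebS_sub (m : ℕ) :
    HasLead (chebS (y + 2) m - chebS (y + 2) ((m : ℤ) - 1)) m := by
  rw [sub_eq_add_neg]
  have := hasLead_y_add_two.chebS le_rfl m
  rw [mul_one] at this
  exact this.add (neg_mem (chebS_y_add_two_mem_degLE m))

/-- By the recurrence this is `S_m - S_{m-1}` at `y + 2`. -/
theorem hasLead_add_one_mul_chebS_sub (m : ℕ) :
    HasLead ((y + 1) * chebS (y + 2) ((m : ℤ) - 1) - chebS (y + 2) ((m : ℤ) - 2)) m := by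
  convert hasLead_chebS_sub m using 1
  have := chebS_add_one (y + 2) ((m : ℤ) - 1)
  rw [sub_add_cancel, sub_sub, one_add_one_eq_two] at this
  rw [this]
  ring

/-- The matrix of `(b a⁻¹)^m (b⁻¹ a)^m`. -/
theorem coe_rho_jWord_even (m : ℕ) :
    (rho (jWord (2 * m))).1 = (rho ((b * a⁻¹) ^ m)).1 * (rho ((b⁻¹ * a) ^ m)).1 := by
  rw [jWord, if_pos (by simp), Nat.mul_div_cancel_left _ two_pos, map_mul,
    Matrix.SpecialLinearGroup.coe_mul]

/-- The matrix of `(b a⁻¹)^m b a (b⁻¹ a)^m`. -/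
theorem coe_rho_jWord_odd (m : ℕ) :
    (rho (jWord (2 * m + 1))).1 =
      (rho ((b * a⁻¹) ^ m)).1 * (rho (b * a)).1 * (rho ((b⁻¹ * a) ^ m)).1 := by
  rw [jWord, if_neg (by simp), show (2 * m + 1) / 2 = m by omega, map_mul, map_mul,
    Matrix.SpecialLinearGroup.coe_mul, Matrix.SpecialLinearGroup.coe_mul]

/-- The term set apart is the dominant one: `Q` has degree `m` and `S` at most `m - 1`, so the
bracket stays below degree `2m + 2`. -/
theorem trace_jWord_odd (m : ℕ) {S Q : LaurentRing} (hS : S = chebS (y + 2) ((m : ℤ) - 1))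
    (hQ : Q = (y + 1) * S - chebS (y + 2) ((m : ℤ) - 2)) :
    (rho (jWord (2 * m + 1))).1 0 0 + (rho (jWord (2 * m + 1))).1 1 1 =
      s 1 * s 1 * (Q * Q) + (s (-1) * s (-1) * (Q * Q) - y * (S * S) - y * (S * (Q + S))
        - y * (Q * S) - y * (Q * Q)) := by
  rw [coe_rho_jWord_odd, coe_rho_b_mul_inv_a_pow, coe_rho_inv_b_mul_a_pow, coe_rho_b_mul_a, ← hS]
  have hs := s_mul_s_neg 1
  -- Solving for `S_{m-2}` leaves an identity in `s`, `s⁻¹`, `y`, `S`, `Q` modulo `s s⁻¹ = 1`.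
  rw [eq_sub_iff_add_eq, ← eq_sub_iff_add_eq'] at hQ
  rw [hQ]
  simp [Matrix.mul_apply, Fin.sum_univ_two]
  grind

theorem rileyOfWord_jWord_odd (m : ℕ) {S Q : LaurentRing} (hS : S = chebS (y + 2) ((m : ℤ) - 1))
    (hQ : Q = (y + 1) * S - chebS (y + 2) ((m : ℤ) - 2)) :
    rileyOfWord (jWord (2 * m + 1)) = -(s 1 * s 1 * (Q * S))
      + (Q * Q + S * Q + S * Q - y * (S * S) - s (-1) * s (-1) * (S * Q)) := by
  rw [rileyOfWord, coe_rho_jWord_odd, coe_rho_b_mul_inv_a_pow, coe_rho_inv_b_mul_a_pow,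
    coe_rho_b_mul_a, ← hS]
  have hs := s_mul_s_neg 1
  rw [eq_sub_iff_add_eq, ← eq_sub_iff_add_eq'] at hQ
  rw [hQ]
  simp [Matrix.mul_apply, Fin.sum_univ_two]
  grind

theorem trace_jWord_even (m : ℕ) {S P : LaurentRing} (hS : S = chebS (y + 2) ((m : ℤ) - 1))
    (hP : P = S - chebS (y + 2) ((m : ℤ) - 2)) :
    (rho (jWord (2 * m))).1 0 0 + (rho (jWord (2 * m))).1 1 1 =
      -(s 1 * s 1 * y * (S * S)) + (P * P - s (-1) * s (-1) * y * (S * S)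
        + (P + y * S) * (P + y * S)) := by
  rw [coe_rho_jWord_even, coe_rho_b_mul_inv_a_pow, coe_rho_inv_b_mul_a_pow, ← hS]
  have hs := s_mul_s_neg 1
  rw [eq_sub_iff_add_eq, ← eq_sub_iff_add_eq'] at hP
  rw [hP]
  simp [Matrix.mul_apply, Fin.sum_univ_two]
  grind

theorem rileyOfWord_jWord_even (m : ℕ) {S P : LaurentRing} (hS : S = chebS (y + 2) ((m : ℤ) - 1))
    (hP : P = S - chebS (y + 2) ((m : ℤ) - 2)) :
    rileyOfWord (jWord (2 * m)) = s 1 * s 1 * (S * P)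
      + (P * P + s (-1) * s (-1) * (S * P) - y * (S * S) - S * P - S * P) := by
  rw [rileyOfWord, coe_rho_jWord_even, coe_rho_b_mul_inv_a_pow, coe_rho_inv_b_mul_a_pow, ← hS]
  have hs := s_mul_s_neg 1
  rw [eq_sub_iff_add_eq, ← eq_sub_iff_add_eq'] at hP
  rw [hP]
  simp [Matrix.mul_apply, Fin.sum_univ_two]
  grind

/-! ### Leading monomials for `q = 1`. -/

theorem mul_mem_degLE_add {m n : ℤ} {p q : LaurentRing} (hp : p ∈ degLE m) (hq : q ∈ degLE n) :
    p * q ∈ degLE (m + n) :=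
  mul_mem_degLE hp hq le_rfl

theorem hasLead_trace_jWord_odd (m : ℕ) :
    HasLead ((rho (jWord (2 * m + 1))).1 0 0 + (rho (jWord (2 * m + 1))).1 1 1)
      (((2 * m + 1 : ℕ) : ℤ) + 1) := by
  rw [trace_jWord_odd m rfl rfl]
  have hQ := hasLead_add_one_mul_chebS_sub m
  have hS := chebS_y_add_two_mem_degLE m
  have key := ((hasLead_s 1).mul (hasLead_s 1)).mul (hQ.mul hQ)
  have hQ' := hQ.mem_degLE
  generalize (y + 1) * chebS (y + 2) ((m : ℤ) - 1) - chebS (y + 2) ((m : ℤ) - 2) = Q at *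
  generalize chebS (y + 2) ((m : ℤ) - 1) = S at *
  rw [show (1 : ℤ) + 1 + (m + m) = ((2 * m + 1 : ℕ) : ℤ) + 1 by push_cast; ring] at key
  have hsi := mul_mem_degLE_add (s_mem_degLE (-1)) (s_mem_degLE (-1))
  have hQS := add_mem hQ' (degLE_mono (by omega) hS)
  refine key.add (sub_mem (sub_mem (sub_mem (sub_mem ?_ ?_) ?_) ?_) ?_)
  · exact mul_mem_degLE hsi (mul_mem_degLE_add hQ' hQ') (by push_cast; omega)
  · exact mul_mem_degLE y_mem_degLE (mul_mem_degLE_add hS hS) (by push_cast; omega)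
  · exact mul_mem_degLE y_mem_degLE (mul_mem_degLE_add hS hQS) (by push_cast; omega)
  · exact mul_mem_degLE y_mem_degLE (mul_mem_degLE_add hQ' hS) (by push_cast; omega)
  · exact mul_mem_degLE y_mem_degLE (mul_mem_degLE_add hQ' hQ') (by push_cast; omega)

/-- The dominant term `-s² Q S` vanishes for `m = 0`, where `S = S_{-1} = 0`; hence the exception `k
= 1`. -/
theorem hasLead_rileyOfWord_jWord_odd {m : ℕ} (hm : 0 < m) :
    HasLead (rileyOfWord (jWord (2 * m + 1))) ((2 * m + 1 : ℕ) : ℤ) := by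
  rw [rileyOfWord_jWord_odd m rfl rfl]
  have hQ := hasLead_add_one_mul_chebS_sub m
  have hS : HasLead (chebS (y + 2) ((m : ℤ) - 1)) (m - 1) := by
    simpa [Nat.cast_pred hm] using hasLead_y_add_two.chebS le_rfl (m - 1)
  have key := (((hasLead_s 1).mul (hasLead_s 1)).mul (hQ.mul hS)).neg
  have hQ' := hQ.mem_degLE
  have hS' := hS.mem_degLE
  generalize (y + 1) * chebS (y + 2) ((m : ℤ) - 1) - chebS (y + 2) ((m : ℤ) - 2) = Q at *
  generalize chebS (y + 2) ((m : ℤ) - 1) = S at *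
  rw [show (1 : ℤ) + 1 + (m + (m - 1)) = ((2 * m + 1 : ℕ) : ℤ) by push_cast; ring] at key
  have hsi := mul_mem_degLE_add (s_mem_degLE (-1)) (s_mem_degLE (-1))
  refine key.add (sub_mem (sub_mem (add_mem (add_mem ?_ ?_) ?_) ?_) ?_)
  · exact mul_mem_degLE hQ' hQ' (by push_cast; omega)
  · exact mul_mem_degLE hS' hQ' (by push_cast; omega)
  · exact mul_mem_degLE hS' hQ' (by push_cast; omega)
  · exact mul_mem_degLE y_mem_degLE (mul_mem_degLE_add hS' hS') (by push_cast; omega)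
  · exact mul_mem_degLE hsi (mul_mem_degLE_add hS' hQ') (by push_cast; omega)

theorem hasLead_rileyOfWord_jWord_one : HasLead (rileyOfWord (jWord 1)) 0 := by
  have h := rileyOfWord_jWord_odd 0 rfl rfl
  have e₁ : chebS (y + 2) (((0 : ℕ) : ℤ) - 1) = 0 := chebS_neg_one _
  have e₂ : chebS (y + 2) (((0 : ℕ) : ℤ) - 2) = -1 := chebS_neg_two _
  rw [e₁, e₂] at h
  have : rileyOfWord (jWord 1) = 1 := by simpa using h
  rw [this]
  exact hasLead_one

theorem hasLead_chebS_sub_pred {m : ℕ} (hm : 0 < m) :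
    HasLead (chebS (y + 2) ((m : ℤ) - 1) - chebS (y + 2) ((m : ℤ) - 2)) (m - 1) := by
  simpa [Nat.cast_pred hm, sub_sub, one_add_one_eq_two] using hasLead_chebS_sub (m - 1)

theorem hasLead_trace_jWord_even {m : ℕ} (hm : 0 < m) :
    HasLead ((rho (jWord (2 * m))).1 0 0 + (rho (jWord (2 * m))).1 1 1)
      (((2 * m : ℕ) : ℤ) + 1) := by
  rw [trace_jWord_even m rfl rfl]
  have hP := (hasLead_chebS_sub_pred hm).mem_degLE
  have hS : HasLead (chebS (y + 2) ((m : ℤ) - 1)) (m - 1) := by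
    simpa [Nat.cast_pred hm] using hasLead_y_add_two.chebS le_rfl (m - 1)
  have key := ((((hasLead_s 1).mul (hasLead_s 1)).mul hasLead_y).mul (hS.mul hS)).neg
  have hS' := hS.mem_degLE
  generalize chebS (y + 2) ((m : ℤ) - 1) - chebS (y + 2) ((m : ℤ) - 2) = P at *
  generalize chebS (y + 2) ((m : ℤ) - 1) = S at *
  rw [show (1 : ℤ) + 1 + 1 + (m - 1 + (m - 1)) = ((2 * m : ℕ) : ℤ) + 1 by push_cast; ring] at key
  have hsi := mul_mem_degLE_add (mul_mem_degLE_add (s_mem_degLE (-1)) (s_mem_degLE (-1)))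
    y_mem_degLE
  have hQ : P + y * S ∈ degLE m :=
    add_mem (degLE_mono (by omega) hP) (mul_mem_degLE y_mem_degLE hS' (by omega))
  refine key.add (add_mem (sub_mem ?_ ?_) ?_)
  · exact mul_mem_degLE hP hP (by push_cast; omega)
  · exact mul_mem_degLE hsi (mul_mem_degLE_add hS' hS') (by push_cast; omega)
  · exact mul_mem_degLE hQ hQ (by push_cast; omega)

theorem hasLead_rileyOfWord_jWord_even {m : ℕ} (hm : 0 < m) :
    HasLead (rileyOfWord (jWord (2 * m))) ((2 * m : ℕ) : ℤ) := by
  rw [rileyOfWord_jWord_even m rfl rfl]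
  have hP := hasLead_chebS_sub_pred hm
  have hS : HasLead (chebS (y + 2) ((m : ℤ) - 1)) (m - 1) := by
    simpa [Nat.cast_pred hm] using hasLead_y_add_two.chebS le_rfl (m - 1)
  have key := ((hasLead_s 1).mul (hasLead_s 1)).mul (hS.mul hP)
  have hP' := hP.mem_degLE
  have hS' := hS.mem_degLE
  generalize chebS (y + 2) ((m : ℤ) - 1) - chebS (y + 2) ((m : ℤ) - 2) = P at *
  generalize chebS (y + 2) ((m : ℤ) - 1) = S at *
  rw [show (1 : ℤ) + 1 + (m - 1 + (m - 1)) = ((2 * m : ℕ) : ℤ) by push_cast; ring] at key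
  have hsi := mul_mem_degLE_add (s_mem_degLE (-1)) (s_mem_degLE (-1))
  refine key.add (sub_mem (sub_mem (sub_mem (add_mem ?_ ?_) ?_) ?_) ?_)
  · exact mul_mem_degLE hP' hP' (by push_cast; omega)
  · exact mul_mem_degLE hsi (mul_mem_degLE_add hS' hP') (by push_cast; omega)
  · exact mul_mem_degLE y_mem_degLE (mul_mem_degLE_add hS' hS') (by push_cast; omega)
  · exact mul_mem_degLE hS' hP' (by push_cast; omega)
  · exact mul_mem_degLE hS' hP' (by push_cast; omega)

theorem hasLead_trace_jWord {k : ℕ} (hk : 0 < k) :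
    HasLead ((rho (jWord k)).1 0 0 + (rho (jWord k)).1 1 1) ((k : ℤ) + 1) := by
  obtain ⟨m, rfl | rfl⟩ := k.even_or_odd'
  · exact hasLead_trace_jWord_even (by omega)
  · exact hasLead_trace_jWord_odd m

theorem hasLead_rileyOfWord_jWord {k : ℕ} (hk : 1 < k) :
    HasLead (rileyOfWord (jWord k)) (k : ℤ) := by
  obtain ⟨m, rfl | rfl⟩ := k.even_or_odd'
  · exact hasLead_rileyOfWord_jWord_even (by omega)
  · exact hasLead_rileyOfWord_jWord_odd (by omega)

end Riley

end

/-- The degrees of the Riley polynomials of the knots `J(k, 2q)`, for `k > 0` and `q > 0` or `q < 0`. -/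
theorem proposition5p2 (k : ℕ) (hk : 0 < k) (q : ℤ) :
    (0 < q → k ≠ 1 →
      Riley.deg (Riley.rileyJ k q) = ((((k : ℤ) + 1) * q - 1 : ℤ) : WithBot ℤ)) ∧
    (q < 0 →
      Riley.deg (Riley.rileyJ k q) = ((((k : ℤ) + 1) * |q| : ℤ) : WithBot ℤ)) ∧
    (0 < q → k = 1 →
      Riley.deg (Riley.rileyJ k q) = ((2 * q - 2 : ℤ) : WithBot ℤ)) := by
  have ht := Riley.hasLead_trace_jWord hk
  refine ⟨fun hq h1 => ?_, fun hq => ?_, fun hq h1 => ?_⟩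
  · have hw := Riley.hasLead_rileyOfWord_jWord (k := k) (by omega)
    rw [Riley.rileyJ,
      (Riley.hasLead_rileyOfWord_zpow_of_pos ht hw (by omega) (by omega) hq).deg_eq]
    congr 1
    ring
  -- The degree of `φ_1` differs in the two cases, but only its being less than `k + 1` matters.
  · rcases eq_or_ne k 1 with rfl | h1
    · exact (Riley.hasLead_rileyOfWord_zpow_of_neg ht Riley.hasLead_rileyOfWord_jWord_one
        (by omega) (by omega) hq).deg_eq
    · exact (Riley.hasLead_rileyOfWord_zpow_of_neg ht
        (Riley.hasLead_rileyOfWord_jWord (by omega)) (by omega) (by omega) hq).deg_eq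
  · subst h1
    rw [Riley.rileyJ, (Riley.hasLead_rileyOfWord_zpow_of_pos ht
      Riley.hasLead_rileyOfWord_jWord_one (by omega) le_rfl hq).deg_eq]
    congr 1
    push_cast
    ring
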